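/- Let $\mathcal F$ be a set system with ground set $X$, that is, a (possibly infinite) set of subsets of $X$. For $P\subseteq X$ let $\mathrm{conv}_{\mathcal F}(P)$ be the intersection of all members of $\mathcal F$ that contain $P$ (and $X$ if there are none). The Radon number $\mathrm{rad}_{\mathcal F}\in\mathbb N\cup\{\infty\}$ is the smallest integer $r$ such that every $r$-element subset $S\subseteq X$ can be partitioned into two nonempty parts $S=P_1\sqcup P_2$ with $\mathrm{conv}_{\mathcal F}(P_1)\cap\mathrm{conv}_{\mathcal F}(P_2)\neq\emptyset$ ($\infty$ if there is no such $r$). The graded Radon numbers are $\mathrm{rad}_{\mathcal F}(t)=\sup\{\mathrm{rad}_{\mathcal F'} : \mathcal F'\subseteq\mathcal F,\ |\mathcal F'|\le t\}$ for $t\in\mathbb N$. The fractional Helly number $\mathrm{fh}_{\mathcal F}\in\mathbb N\cup\{\infty\}$ is the smallest integer $s$ for which there is a function $\beta:(0,1)\to(0,1)$ such that for every $\alpha\in(0,1)$ and every finite $\mathcal F'\subseteq\mathcal F$ with $|\mathcal F'|\ge s$: if at least $\alpha\binom{|\mathcal F'|}{s}$ of the $s$-element subfamilies of $\mathcal F'$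 have nonempty intersection, then some $\mathcal G\subseteq\mathcal F'$ with $|\mathcal G|\ge\beta(\alpha)|\mathcal F'|$ has nonempty intersection ($\infty$ if there is no such $s$). Let $\Xi(r)=r^{\,r^{\lceil\log_2 r\rceil}+r\lceil\log_2 r\rceil}$. **Theorem.** Let $\Psi:\mathbb N\to\mathbb N$ and $t_0\in\mathbb N$ be such that $\Psi(t)<t+1$ for every $t\ge t_0$. Suppose that there is an integer $t_1\ge t_0^2$ with $\Xi(\Psi(t_1))<\dfrac{t_1}{\Psi(t_0)}$ (in particular $\Psi(t_0)\neq 0$). Then there is an integer $N$, depending only on $\Psi$, $t_0$ and $t_1$, such that every set system $\mathcal F$ with $\mathrm{rad}_{\mathcal F}(t)\le\Psi(t)$ for all $t\in\mathbb N$ satisfies $\mathrm{fh}_{\mathcal F}\le N$. -/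

import Mathlib

namespace SetSystem

/-- The `F`-convex hull of `P`: the intersection of all members of `F` that contain `P`
(the whole ground set `X` if there is no such member). -/
def hull {X : Type*} (F : Set (Set X)) (P : Set X) : Set X :=
  ⋂₀ {A | A ∈ F ∧ P ⊆ A}

/-- Every `r`-element subset of the ground set splits into two nonempty parts whose
`F`-convex hulls meet. -/
def RadonProperty {X : Type*} (F : Set (Set X)) (r : ℕ) : Prop :=
  ∀ S : Finset X, S.card = r →
    ∃ P₁ P₂ : Set X, P₁.Nonempty ∧ P₂.Nonempty ∧ Disjoint P₁ P₂ ∧ P₁ ∪ P₂ = (S : Set X) ∧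
      (hull F P₁ ∩ hull F P₂).Nonempty

/-- The Radon number: the least `r` with the Radon property, `⊤` if there is none. -/
noncomputable def radonNumber {X : Type*} (F : Set (Set X)) : ℕ∞ :=
  ⨅ (r : ℕ) (_ : RadonProperty F r), (r : ℕ∞)

/-- The graded Radon number at `t`: the supremum of the Radon numbers of the subfamilies of
size at most `t` (on the same ground set). -/
noncomputable def gradedRadonNumber {X : Type*} (F : Set (Set X)) (t : ℕ) : ℕ∞ :=
  ⨆ (F' : Set (Set X)) (_ : F' ⊆ F) (_ : F'.encard ≤ (t : ℕ∞)), radonNumber F'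

open Classical in
/-- The number of `s`-element subfamilies of the finite family `F'` whose members have a
common point. -/
noncomputable def intersectingCount {X : Type*} (F' : Finset (Set X)) (s : ℕ) : ℕ :=
  ((F'.powersetCard s).filter fun T : Finset (Set X) => (⋂₀ (T : Set (Set X))).Nonempty).card

/-- There is a function `β : (0,1) → (0,1)` such that, in every finite subfamily `F'` of `F`
with at least `s` members, if at least a fraction `α` of the `s`-element subfamilies have a
common point, then some `G ⊆ F'` of size at least `β α * |F'|` has a common point.
(A family with fewer than `s` members has no `s`-tuples, so nothing is asked of it.) -/
def FractionalHellyProperty {X : Type*} (F : Set (Set X)) (s : ℕ) : Prop :=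
  ∃ β : Set.Ioo (0 : ℝ) 1 → Set.Ioo (0 : ℝ) 1,
    ∀ (α : Set.Ioo (0 : ℝ) 1) (F' : Finset (Set X)), (F' : Set (Set X)) ⊆ F → s ≤ F'.card →
      (α : ℝ) * ((F'.powersetCard s).card : ℝ) ≤ (intersectingCount F' s : ℝ) →
      ∃ G : Finset (Set X), G ⊆ F' ∧ (β α : ℝ) * (F'.card : ℝ) ≤ (G.card : ℝ) ∧
        (⋂₀ (G : Set (Set X))).Nonempty

/-- The fractional Helly number: the least `s` with the fractional Helly property, `⊤` if
there is none. -/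
noncomputable def fractionalHellyNumber {X : Type*} (F : Set (Set X)) : ℕ∞ :=
  ⨅ (s : ℕ) (_ : FractionalHellyProperty F s), (s : ℕ∞)

/-- `Ξ(r) = r ^ (r ^ ⌈log₂ r⌉ + r ⌈log₂ r⌉)`. -/
noncomputable def Xi (r : ℕ) : ℕ :=
  r ^ (r ^ ⌈Real.logb 2 (r : ℝ)⌉₊ + r * ⌈Real.logb 2 (r : ℝ)⌉₊)

end SetSystem

namespace SetSystem

/-! Fractional Helly follows from Helly and colorful Helly, and both come from Radon partitions.
Helly: by Levi's argument a minimal family with empty intersection is smaller than its Radon number.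
Since `Ψ t ≤ t` from `t₀` on, its size stays below `Ψ t₀`. Colorful Helly: put `r = Ψ t₁`, `r ≤ 2 ^
L`. Iterated Radon partitions split `r ^ L` points into at least `r` parts whose hulls meet. Index
the `r ^ r ^ L` colors by the maps from these points to `Fin r`. If every transversal had a common
point, the color that is the partition itself would have one too. Minimal families in that many
colors have at most `t₁` members together, by the condition on `Ξ`, so `r` does bound the Radon
number of their union. The passage to fractional Helly is pure counting. Let `P` mark the tuples
with empty intersection. Many unmarked tuples yield either blocks with no marked transversal,
against colorful Helly, or a linear-size set with few marked tuples. In the latter, disjoint marked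
blocks would produce too many marked transversals, unless some linear-size set has none; by Helly
that set has a common point. -/

/-! ### Counting in dense sets of tuples -/

/-- Every dense set of `s`-tuples contains all transversals of some `s` blocks satisfying `P`,
or else some set of linear size contains few `k`-tuples satisfying `P`. -/
theorem exists_blocks_or_sparse (k s : ℕ) : ∀ α : ℝ, 0 < α → ∀ ε : ℝ, 0 < ε →
    ∃ c : ℝ, 0 < c ∧ ∀ (V : Type*) [Fintype V] [Nonempty V]
      (P : (Fin k → V) → Prop) (K : Set (Fin s → V)),
      α * (Fintype.card V : ℝ) ^ s ≤ (K.ncard : ℝ) →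
      (∃ M : Fin s → Fin k → V, (∀ i, P (M i)) ∧
        ∀ e : Fin s → Fin k, (fun i => M i (e i)) ∈ K) ∨
      ∃ W : Set V, c * (Fintype.card V : ℝ) ≤ (W.ncard : ℝ) ∧
        ({M : Fin k → V | P M ∧ ∀ i, M i ∈ W}.ncard : ℝ) ≤ ε * (W.ncard : ℝ) ^ k := by
  classical
  induction s with
  | zero =>
    intro α hα ε hε
    refine ⟨1, one_pos, fun V _ _ P K hK => Or.inl ?_⟩
    have hpos : 0 < K.ncard := by
      have : (0 : ℝ) < K.ncard := lt_of_lt_of_le (by simpa using hα) hK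
      exact_mod_cast this
    obtain ⟨x, hx⟩ := Set.nonempty_of_ncard_ne_zero hpos.ne'
    exact ⟨fun i => i.elim0, fun i => i.elim0, fun e => by convert hx⟩
  | succ s ih =>
    intro α hα ε hε
    -- Calibrated so that `δ / (ε * (α / 2) ^ k) = α / 4`, the loss in the double count below.
    set δ : ℝ := ε * (α / 2) ^ (k + 1) / 2 with hδ
    have hδ0 : 0 < δ := by positivity
    obtain ⟨c, hc, hcV⟩ := ih δ hδ0 ε hε
    refine ⟨min c (α / 2), lt_min hc (by positivity), fun V _ _ P K hK => ?_⟩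
    set n : ℝ := (Fintype.card V : ℝ) with hn
    have hn0 : 0 < n := by simp only [hn]; exact_mod_cast Fintype.card_pos
    let link : (Fin k → V) → Set (Fin s → V) := fun M => {T | ∀ a, Fin.cons (M a) T ∈ K}
    by_cases hbig : ∃ M, P M ∧ δ * n ^ s ≤ ((link M).ncard : ℝ)
    · obtain ⟨M, hPM, hM⟩ := hbig
      rcases hcV V P (link M) hM with ⟨M', hP', hM'⟩ | ⟨W, hW, hW'⟩
      · refine Or.inl ⟨Fin.cons M M', fun i => ?_, fun e => ?_⟩
        · refine Fin.cases ?_ (fun i => ?_) i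
          · simpa using hPM
          · simpa using hP' i
        · have := hM' (fun i => e i.succ) (e 0)
          convert this using 1
          funext i
          refine Fin.cases ?_ (fun i => ?_) i <;> simp
      · exact Or.inr ⟨W, le_trans (by gcongr; exact min_le_left _ _) hW, hW'⟩
    -- Every block satisfying `P` now has a sparse common link. Count pairs of such a block `M` and
    -- a `T` with `M` inside `N T`. If every linear-size set held many blocks, few `T` could have a
    -- large `N T`, and `K` would have density at most `3α/4`.
    · push Not at hbig
      right
      by_contra hcon
      push Not at hcon
      let N : (Fin s → V) → Set V := fun T => {v | Fin.cons v T ∈ K}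
      let miss : (Fin s → V) → Set (Fin k → V) := fun T => {M | P M ∧ ∀ i, M i ∈ N T}
      have hsumK : (K.ncard : ℝ) = ∑ T, ((N T).ncard : ℝ) := by
        have h1 : K.ncard = ∑ T, (N T).ncard := by
          simp only [Set.ncard_eq_toFinset_card']
          rw [← Finset.card_sigma]
          refine Finset.card_bij' (fun f _ => ⟨fun i => f i.succ, f 0⟩)
            (fun x _ => Fin.cons x.2 x.1) ?_ ?_ ?_ ?_
          · intro f hf
            simp only [Finset.mem_sigma, Finset.mem_univ, true_and, Set.mem_toFinset, N,
              Set.mem_ofPred_eq] at hf ⊢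
            convert hf
            exact Fin.cons_self_tail f
          · intro x hx
            simpa [N] using hx
          · intro f _
            exact Fin.cons_self_tail f
          · intro x _
            simp
        exact_mod_cast h1
      have hsumM : ∑ T, ((miss T).ncard : ℝ) ≤ n ^ k * (δ * n ^ s) := by
        have h1 : ∑ T, (miss T).ncard =
            ∑ M : Fin k → V, if P M then (link M).ncard else 0 := by
          have h2 : ∀ T, (miss T).ncard =
              ∑ M : Fin k → V, if P M ∧ ∀ i, Fin.cons (M i) T ∈ K then 1 else 0 := by
            intro T
            rw [Set.ncard_eq_toFinset_card', ← Finset.card_filter]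
            congr 1
            ext M
            simp [miss, N]
          simp only [h2]
          rw [Finset.sum_comm]
          refine Finset.sum_congr rfl fun M _ => ?_
          by_cases hP : P M
          · simp only [hP, true_and, if_true]
            rw [Set.ncard_eq_toFinset_card', ← Finset.card_filter]
            congr 1
            ext T
            simp [link]
          · simp [hP]
        have h3 : ∑ T, ((miss T).ncard : ℝ) =
            ∑ M : Fin k → V, ((if P M then (link M).ncard else 0 : ℕ) : ℝ) := by
          exact_mod_cast h1
        rw [h3]
        calc _ ≤ ∑ _M : Fin k → V, δ * n ^ s := by
              refine Finset.sum_le_sum fun M _ => ?_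
              by_cases hP : P M
              · simpa [hP] using (hbig M hP).le
              · simp only [hP, if_false, Nat.cast_zero]; positivity
          _ = n ^ k * (δ * n ^ s) := by simp [hn]
      have hpt : ∀ T, ((N T).ncard : ℝ) ≤
          α / 2 * n + n / (ε * (α / 2) ^ k * n ^ k) * ((miss T).ncard : ℝ) := by
        intro T
        by_cases hT : α / 2 * n ≤ ((N T).ncard : ℝ)
        · have h1 := hcon (N T) (le_trans (by gcongr; exact min_le_right _ _) hT)
          have h2 : ε * (α / 2) ^ k * n ^ k ≤ ((miss T).ncard : ℝ) := by
            refine le_trans ?_ h1.le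
            rw [mul_assoc, ← mul_pow]
            gcongr
          have h3 : ((N T).ncard : ℝ) ≤ n := by
            have : (N T).ncard ≤ Fintype.card V := by
              rw [← Nat.card_eq_fintype_card]; exact Set.ncard_le_card _
            rw [hn]
            exact_mod_cast this
          have h4 : n ≤ n / (ε * (α / 2) ^ k * n ^ k) * ((miss T).ncard : ℝ) := by
            rw [div_mul_eq_mul_div, le_div_iff₀ (by positivity)]
            gcongr
          have : 0 ≤ α / 2 * n := by positivity
          linarith
        · have : 0 ≤ n / (ε * (α / 2) ^ k * n ^ k) * ((miss T).ncard : ℝ) := by positivity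
          linarith
      have htot : (K.ncard : ℝ) ≤ n ^ s * (α / 2 * n) +
          n / (ε * (α / 2) ^ k * n ^ k) * (n ^ k * (δ * n ^ s)) := by
        rw [hsumK]
        refine (Finset.sum_le_sum fun T _ => hpt T).trans ?_
        rw [Finset.sum_add_distrib, ← Finset.mul_sum (f := fun T => ((miss T).ncard : ℝ))]
        refine add_le_add ?_ (mul_le_mul_of_nonneg_left hsumM (by positivity))
        simp [hn]
      have heq : n / (ε * (α / 2) ^ k * n ^ k) * (n ^ k * (δ * n ^ s)) = α / 4 * n ^ (s + 1) := by
        rw [hδ]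
        field_simp
        ring
      rw [heq] at htot
      have hpos : 0 < α * n ^ (s + 1) := by positivity
      have : n ^ s * (α / 2 * n) = α / 2 * n ^ (s + 1) := by ring
      linarith

/-- If every subset of at least half the size of `W` contains a `k`-tuple satisfying `P`, then
`W` contains linearly many disjoint such tuples. -/
theorem exists_disjoint_blocks {V : Type*} [Fintype V] {k : ℕ} (hk : 0 < k)
    (P : (Fin k → V) → Prop) (W : Set V)
    (h : ∀ U ⊆ W, W.ncard ≤ 2 * U.ncard → ∃ M, P M ∧ ∀ i, M i ∈ U) :
    ∃ (q : ℕ) (B : Fin q → Fin k → V), (∀ j, P (B j)) ∧ (∀ j i, B j i ∈ W) ∧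
      (∀ j j' i i', B j i = B j' i' → j = j') ∧ W.ncard ≤ 2 * k * q := by
  classical
  by_contra hcon
  push Not at hcon
  have key : ∀ q : ℕ, ∃ B : Fin q → Fin k → V, (∀ j, P (B j)) ∧ (∀ j i, B j i ∈ W) ∧
      (∀ j j' i i', B j i = B j' i' → j = j') := by
    intro q
    induction q with
    | zero => exact ⟨fun j => j.elim0, fun j => j.elim0, fun j => j.elim0, fun j => j.elim0⟩
    | succ q ih =>
      obtain ⟨B, hB, hBW, hBd⟩ := ih
      have hlt := hcon q B hB hBW hBd
      let R : Set V := Set.range fun x : Fin q × Fin k => B x.1 x.2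
      have hR : R.ncard ≤ q * k := by
        have : R.ncard ≤ Nat.card (Fin q × Fin k) := by
          rw [← Nat.card_coe_set_eq]
          exact Finite.card_range_le _
        simpa using this
      -- The `q` blocks cover at most `q * k` points, less than half of `W`.
      obtain ⟨M, hM, hMU⟩ := h (W \ R) Set.sdiff_subset (by
        have h1 := Set.le_ncard_sdiff R W
        have h2 : 2 * k * q = 2 * (q * k) := by ring
        omega)
      have hne : ∀ j i i', M i ≠ B j i' := fun j i i' heq =>
        (hMU i).2 ⟨(j, i'), heq.symm⟩
      refine ⟨Fin.cons M B, fun j => ?_, fun j => ?_, fun j j' => ?_⟩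
      · refine Fin.cases ?_ (fun j => ?_) j
        · simpa using hM
        · simpa using hB j
      · refine Fin.cases ?_ (fun j => ?_) j
        · simpa using fun i => (hMU i).1
        · simpa using hBW j
      · refine Fin.cases ?_ (fun j => ?_) j <;> refine Fin.cases ?_ (fun j' => ?_) j'
        · simp
        · intro i i' heq
          exact absurd (by simpa using heq) (hne j' i i')
        · intro i i' heq
          exact absurd (by simpa using heq.symm) (hne j i' i)
        · intro i i' heq
          rw [hBd j j' i i' (by simpa using heq)]
  obtain ⟨B, hB, hBW, hBd⟩ := key W.ncard
  have := hcon _ B hB hBW hBd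
  nlinarith

/-- If any `m` blocks of `m` vertices satisfying `P` have a transversal satisfying `P`, and a
positive fraction of the `m`-tuples do not satisfy `P`, then there is a set of linear size
containing no `m`-tuple that satisfies `P`. -/
theorem exists_large_clique {m : ℕ} (hm : 0 < m) (α : ℝ) (hα : 0 < α) :
    ∃ β : ℝ, 0 < β ∧ β < 1 ∧ ∀ (V : Type*) [Fintype V] [Nonempty V] (P : (Fin m → V) → Prop),
      (∀ M : Fin m → Fin m → V, (∀ i, P (M i)) → ∃ e : Fin m → Fin m, P fun i => M i (e i)) →
      α * (Fintype.card V : ℝ) ^ m ≤ ({v | ¬ P v}.ncard : ℝ) →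
      ∃ U : Set V, β * (Fintype.card V : ℝ) ≤ (U.ncard : ℝ) ∧
        ∀ M : Fin m → V, (∀ i, M i ∈ U) → ¬ P M := by
  classical
  have hm' : (0 : ℝ) < m := by exact_mod_cast hm
  -- The factor `m ^ m` pays for the choices of `e`, `(2 * m) ^ m` for passing from `W` to `q`, and
  -- the 2 leaves a strict contradiction.
  set ε : ℝ := 1 / (2 * (m : ℝ) ^ m * (2 * m : ℝ) ^ m) with hε
  obtain ⟨c, hc, hcV⟩ := exists_blocks_or_sparse m m α hα ε (by positivity)
  refine ⟨min (c / 2) (1 / 2), by positivity, (min_le_right _ _).trans_lt (by norm_num),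
    fun V _ _ P hcol hdens => ?_⟩
  have hn0 : (0 : ℝ) < Fintype.card V := by exact_mod_cast Fintype.card_pos
  by_contra hcon
  push Not at hcon
  rcases hcV V P {v | ¬ P v} hdens with ⟨M, hM, hMe⟩ | ⟨W, hWn, hW⟩
  · obtain ⟨e, he⟩ := hcol M hM
    exact hMe e he
  obtain ⟨q, B, hB, hBW, hBd, hq⟩ := exists_disjoint_blocks hm P W (by
    intro U _ hU
    obtain ⟨M, hMU, hM⟩ := hcon U (by
      have h1 : (W.ncard : ℝ) ≤ 2 * U.ncard := by exact_mod_cast hU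
      have h2 : min (c / 2) (1 / 2) * (Fintype.card V : ℝ) ≤ c / 2 * Fintype.card V := by
        gcongr; exact min_le_left _ _
      linarith)
    exact ⟨M, hM, hMU⟩)
  have hqR : (W.ncard : ℝ) ≤ 2 * m * q := by exact_mod_cast hq
  have hW0 : (0 : ℝ) < W.ncard := lt_of_lt_of_le (by positivity) hWn
  have hq0 : (0 : ℝ) < q := by
    by_contra hq'
    have : (q : ℝ) = 0 := le_antisymm (not_lt.mp hq') (by positivity)
    rw [this] at hqR
    linarith
  -- Each of the `q ^ m` tuples of blocks has a transversal satisfying `P`. For fixed `e`,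
  -- disjointness lets the transversal determine the blocks.
  have hcount : (q : ℝ) ^ m ≤ (m : ℝ) ^ m * (ε * (W.ncard : ℝ) ^ m) := by
    have h1 : (Finset.univ : Finset (Fin m → Fin q)) ⊆
        Finset.univ.biUnion fun e : Fin m → Fin m =>
          Finset.univ.filter fun i : Fin m → Fin q => P fun j => B (i j) (e j) := by
      intro i _
      obtain ⟨e, he⟩ := hcol (fun j => B (i j)) fun j => hB _
      simpa using ⟨e, he⟩
    have h2 : ∀ e : Fin m → Fin m,
        ((Finset.univ.filter fun i : Fin m → Fin q => P fun j => B (i j) (e j)).card : ℝ) ≤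
          ε * (W.ncard : ℝ) ^ m := by
      intro e
      refine le_trans ?_ hW
      rw [Set.ncard_eq_toFinset_card']
      have : (Finset.univ.filter fun i : Fin m → Fin q => P fun j => B (i j) (e j)).card ≤
          ({M : Fin m → V | P M ∧ ∀ i, M i ∈ W}.toFinset).card := by
        refine Finset.card_le_card_of_injOn (fun i j => B (i j) (e j)) ?_ ?_
        · intro i hi
          simp only [Finset.coe_filter, Finset.mem_univ, true_and, Set.mem_ofPred_eq] at hi
          simpa using ⟨hi, fun j => hBW _ _⟩
        · intro i _ i' _ hii
          funext j
          exact hBd _ _ _ _ (congrFun hii j)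
      exact_mod_cast this
    have h3 := (Finset.card_le_card h1).trans Finset.card_biUnion_le
    have h4 : ((Finset.univ : Finset (Fin m → Fin q)).card : ℝ) ≤
        ∑ e : Fin m → Fin m,
        ((Finset.univ.filter fun i : Fin m → Fin q => P fun j => B (i j) (e j)).card : ℝ) := by
      exact_mod_cast h3
    have h5 := h4.trans (Finset.sum_le_sum fun e _ => h2 e)
    simpa using h5
  have hle : (m : ℝ) ^ m * (ε * (W.ncard : ℝ) ^ m) ≤ (q : ℝ) ^ m / 2 := by
    calc (m : ℝ) ^ m * (ε * (W.ncard : ℝ) ^ m) ≤ (m : ℝ) ^ m * (ε * (2 * m * q) ^ m) := by gcongr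
      _ = (q : ℝ) ^ m / 2 := by
        rw [hε, mul_pow (2 * (m : ℝ)) q]
        field_simp
  have : (0 : ℝ) < (q : ℝ) ^ m := by positivity
  linarith


/-! ### Hulls, Radon and Tverberg partitions -/

theorem hull_mono {X : Type*} (F : Set (Set X)) {P Q : Set X} (h : P ⊆ Q) :
    hull F P ⊆ hull F Q :=
  Set.sInter_subset_sInter fun _ hA => ⟨hA.1, h.trans hA.2⟩

theorem subset_hull {X : Type*} (F : Set (Set X)) (P : Set X) : P ⊆ hull F P :=
  Set.subset_sInter fun _ hA => hA.2

theorem hull_subset {X : Type*} {F : Set (Set X)} {P A : Set X} (hA : A ∈ F) (h : P ⊆ A) :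
    hull F P ⊆ A :=
  Set.sInter_subset_of_mem ⟨hA, h⟩

theorem hull_subset_hull {X : Type*} {F : Set (Set X)} {P Q : Set X} (h : P ⊆ hull F Q) :
    hull F P ⊆ hull F Q :=
  Set.subset_sInter fun _ hA => hull_subset hA.1 (h.trans (hull_subset hA.1 hA.2))

/-- Every family of points indexed by `ι` can be split into parts indexed by `κ` whose hulls have
a common point. -/
def TverbergProperty {X : Type*} (F : Set (Set X)) (ι κ : Type*) : Prop :=
  ∀ p : ι → X, ∃ (f : ι → κ) (x : X), ∀ c, x ∈ hull F (p '' {i | f i = c})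

theorem RadonProperty.pos {X : Type*} {F : Set (Set X)} {r : ℕ} (h : RadonProperty F r) :
    0 < r := by
  rcases Nat.eq_zero_or_pos r with rfl | hr
  · obtain ⟨P₁, P₂, h₁, _, _, hu, _⟩ := h ∅ rfl
    obtain ⟨x, hx⟩ := h₁
    have : x ∈ P₁ ∪ P₂ := Or.inl hx
    rw [hu] at this
    simp at this
  · exact hr

/-- The points may repeat: a repeated point, placed in both parts, already lies in both hulls.
Surplus points only enlarge a hull. -/
theorem RadonProperty.tverberg {X : Type*} {F : Set (Set X)} {r : ℕ} (h : RadonProperty F r)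
    {ι : Type*} [Fintype ι] (hι : r ≤ Fintype.card ι) : TverbergProperty F ι Bool := by
  classical
  intro p
  by_cases hp : Function.Injective p
  · have hcard : r ≤ (Finset.univ.image p).card := by
      rwa [Finset.card_image_of_injective _ hp, Finset.card_univ]
    obtain ⟨S, hS, hSr⟩ := Finset.exists_subset_card_eq hcard
    obtain ⟨P₁, P₂, -, -, hd, hu, x, hx₁, hx₂⟩ := h S hSr
    have hsub : ∀ y ∈ P₁ ∪ P₂, ∃ i, p i = y := by
      intro y hy
      rw [hu] at hy
      simpa using hS hy
    refine ⟨fun i => decide (p i ∈ P₁), x, fun c => ?_⟩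
    cases c
    · refine hull_mono F (fun y hy => ?_) hx₂
      obtain ⟨i, rfl⟩ := hsub y (Or.inr hy)
      exact ⟨i, by simpa using fun h₁ => Set.disjoint_left.mp hd h₁ hy, rfl⟩
    · refine hull_mono F (fun y hy => ?_) hx₁
      obtain ⟨i, rfl⟩ := hsub y (Or.inl hy)
      exact ⟨i, by simpa using hy, rfl⟩
  · simp only [Function.Injective, not_forall] at hp
    obtain ⟨a, b, hab, hne⟩ := hp
    refine ⟨fun i => decide (i = a), p a, fun c => subset_hull F _ ?_⟩
    cases c
    · exact ⟨b, by simpa using Ne.symm hne, hab.symm⟩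
    · exact ⟨a, by simp, rfl⟩

/-- Partition each slice, then partition the common points so obtained; idempotence of the hull
merges the two levels. -/
theorem TverbergProperty.prod {X : Type*} {F : Set (Set X)} {ι κ ι' κ' : Type*}
    (h : TverbergProperty F ι κ) (h' : TverbergProperty F ι' κ') :
    TverbergProperty F (ι × ι') (κ × κ') := by
  intro p
  choose f y hy using fun b : ι' => h fun a => p (a, b)
  obtain ⟨g, x, hx⟩ := h' y
  refine ⟨fun i => (f i.2 i.1, g i.2), x, fun c => ?_⟩
  refine hull_subset_hull ?_ (hx c.2)
  rintro _ ⟨b, hb, rfl⟩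
  refine hull_mono F ?_ (hy b c.1)
  rintro _ ⟨a, ha, rfl⟩
  exact ⟨(a, b), Prod.ext ha hb, rfl⟩

theorem RadonProperty.exists_tverberg {X : Type*} {F : Set (Set X)} {r : ℕ}
    (h : RadonProperty F r) (L : ℕ) :
    ∃ (ι κ : Type) (_ : Fintype ι) (_ : Fintype κ), Fintype.card ι = r ^ L ∧
      Fintype.card κ = 2 ^ L ∧ TverbergProperty F ι κ := by
  induction L with
  | zero =>
    exact ⟨Unit, Unit, inferInstance, inferInstance, by simp, by simp, fun p =>
      ⟨id, p (), fun c => subset_hull F _ ⟨(), by simp, rfl⟩⟩⟩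
  | succ L ih =>
    obtain ⟨ι, κ, _, _, hι, hκ, hT⟩ := ih
    exact ⟨Fin r × ι, Bool × κ, inferInstance, inferInstance, by simp [hι, pow_succ'],
      by simp [hκ, pow_succ'], (h.tverberg (by simp)).prod hT⟩

theorem RadonProperty.mono {X : Type*} {F : Set (Set X)} {r r' : ℕ} (h : RadonProperty F r)
    (hr : r ≤ r') : RadonProperty F r' := by
  classical
  intro S hS
  obtain ⟨S', hS', hc⟩ := Finset.exists_subset_card_eq (hr.trans hS.ge)
  obtain ⟨P₁, P₂, h₁, h₂, hd, hu, hx⟩ := h S' hc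
  have hP : P₁ ∪ P₂ ⊆ (S : Set X) := hu ▸ Finset.coe_subset.mpr hS'
  refine ⟨P₁, S \ P₁, h₁, ?_, Set.disjoint_sdiff_right, ?_, ?_⟩
  · obtain ⟨y, hy⟩ := h₂
    exact ⟨y, hP (Or.inr hy), fun h' => Set.disjoint_left.mp hd h' hy⟩
  · exact Set.union_sdiff_cancel (Set.subset_union_left.trans hP)
  · refine hx.mono (Set.inter_subset_inter_right _ (hull_mono F fun y hy => ?_))
    exact ⟨hP (Or.inr hy), fun h' => Set.disjoint_left.mp hd h' hy⟩

/-- The Radon property is upward closed in `r`, so a bound on the infimum gives the property at the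
bound itself. -/
theorem radonProperty_of_gradedRadonNumber_le {X : Type*} {F F' : Set (Set X)} {t r : ℕ}
    (h : gradedRadonNumber F t ≤ (r : ℕ∞)) (hF : F' ⊆ F) (ht : F'.encard ≤ (t : ℕ∞)) :
    RadonProperty F' r := by
  have h1 : radonNumber F' ≤ (r : ℕ∞) := by
    refine le_trans ?_ h
    unfold gradedRadonNumber
    exact le_iSup_of_le F' (le_iSup_of_le hF (le_iSup_of_le ht le_rfl))
  by_contra hcon
  have h2 : ((r + 1 : ℕ) : ℕ∞) ≤ radonNumber F' := by
    refine le_iInf₂ fun r' hr' => ?_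
    have : r < r' := by
      by_contra hle
      exact hcon (hr'.mono (not_lt.mp hle))
    exact_mod_cast this
  have h3 := h2.trans h1
  have : r + 1 ≤ r := by exact_mod_cast h3
  omega

/-! ### Helly and colorful Helly theorems -/

/-- A family with empty intersection, all of whose proper subfamilies have a common point, is
smaller than its Radon number (Levi). -/
theorem RadonProperty.card_lt {X : Type*} {F : Set (Set X)} {r : ℕ} (h : RadonProperty F r)
    (B : Finset (Set X)) (hB : (B : Set (Set X)) ⊆ F) (hempty : ⋂₀ (B : Set (Set X)) = ∅)
    (hmin : ∀ A ∈ B, (⋂₀ ((B : Set (Set X)) \ {A})).Nonempty) : B.card < r := by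
  by_contra hr
  choose p hp using fun A : B => hmin A.1 A.2
  obtain ⟨f, x, hx⟩ := h.tverberg (ι := B) (by simpa using hr) p
  have hmem : x ∈ ⋂₀ (B : Set (Set X)) := by
    intro A hA
    -- Only the point chosen for `A` itself may miss `A`; the part not containing it lies in `A`.
    refine hull_subset (hB hA) ?_ (hx (!f ⟨A, hA⟩))
    rintro _ ⟨i, hi, rfl⟩
    refine hp i A ⟨hA, fun hAi => ?_⟩
    have : i = ⟨A, hA⟩ := Subtype.ext (Set.mem_singleton_iff.mp hAi).symm
    subst this
    simp at hi
  rw [hempty] at hmem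
  exact hmem

theorem exists_minimal_empty {X : Type*} (B : Finset (Set X))
    (hempty : ⋂₀ (B : Set (Set X)) = ∅) :
    ∃ C ⊆ B, ⋂₀ (C : Set (Set X)) = ∅ ∧
      ∀ A ∈ C, (⋂₀ ((C : Set (Set X)) \ {A})).Nonempty := by
  classical
  induction B using Finset.strongInduction with
  | H B ih =>
    by_cases h : ∀ A ∈ B, (⋂₀ ((B : Set (Set X)) \ {A})).Nonempty
    · exact ⟨B, subset_rfl, hempty, h⟩
    · push Not at h
      obtain ⟨A, hA, hAe⟩ := h
      obtain ⟨C, hC, hC'⟩ := ih (B.erase A) (Finset.erase_ssubset hA) (by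
        rw [Finset.coe_erase]; exact hAe)
      exact ⟨C, hC.trans (Finset.erase_subset _ _), hC'⟩

/-- Helly's theorem: minimal families without a common point have size less than `Ψ t₀`. -/
theorem exists_minimal_empty_card_lt {X : Type*} {F : Set (Set X)} {Ψ : ℕ → ℕ} {t₀ : ℕ}
    (hΨ : ∀ t : ℕ, t₀ ≤ t → Ψ t < t + 1)
    (hF : ∀ t : ℕ, gradedRadonNumber F t ≤ (Ψ t : ℕ∞)) (B : Finset (Set X))
    (hB : (B : Set (Set X)) ⊆ F) (hempty : ⋂₀ (B : Set (Set X)) = ∅) :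
    ∃ C ⊆ B, ⋂₀ (C : Set (Set X)) = ∅ ∧
      (∀ A ∈ C, (⋂₀ ((C : Set (Set X)) \ {A})).Nonempty) ∧ C.card < Ψ t₀ := by
  obtain ⟨C, hCB, hC, hmin⟩ := exists_minimal_empty B hempty
  refine ⟨C, hCB, hC, hmin, ?_⟩
  have hCF : (C : Set (Set X)) ⊆ F := (Finset.coe_subset.mpr hCB).trans hB
  have key : ∀ t, C.card ≤ t → C.card < Ψ t := fun t ht =>
    (radonProperty_of_gradedRadonNumber_le (hF t) hCF (by
      rw [Set.encard_coe_eq_coe_finsetCard]; exact_mod_cast ht)).card_lt C subset_rfl hC hmin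
  refine key t₀ ?_
  -- If `C.card` exceeded `t₀`, then taking `t = C.card` would give `C.card < Ψ C.card ≤ C.card`.
  by_contra hlt
  have h1 := key C.card le_rfl
  have h2 := hΨ C.card (by omega)
  omega

/-- Colorful Helly theorem with `r ^ r ^ L` colors, where `r` is the Radon number and
`r ≤ 2 ^ L`. -/
theorem RadonProperty.colorful {X : Type*} {F : Set (Set X)} {r L : ℕ} (h : RadonProperty F r)
    (hL : r ≤ 2 ^ L) (hX : Nonempty X) {I : Type*} [Fintype I] (hI : Fintype.card I = r ^ r ^ L)
    (C : I → Finset (Set X)) (hCF : ∀ i, (C i : Set (Set X)) ⊆ F)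
    (hC : ∀ i, ⋂₀ (C i : Set (Set X)) = ∅)
    (hmin : ∀ i, ∀ A ∈ C i, (⋂₀ ((C i : Set (Set X)) \ {A})).Nonempty) :
    ∃ v : I → Set X, (∀ i, v i ∈ C i) ∧ ⋂ i, v i = ∅ := by
  classical
  have hr := h.pos
  have : NeZero r := ⟨hr.ne'⟩
  obtain ⟨ι, κ, _, _, hι, hκ, hT⟩ := h.exists_tverberg L
  -- A color is a map from Tverberg points to `Fin r`: its value at `s` says which member the
  -- transversal of `s` takes from that color.
  obtain ⟨col⟩ : Nonempty ((ι → Fin r) ≃ I) :=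
    ⟨Fintype.equivOfCardEq (by simp [hI, hι])⟩
  obtain ⟨π, hπ⟩ : ∃ π : κ → Fin r, Function.Surjective π := by
    obtain ⟨g⟩ : Nonempty (Fin r ↪ κ) :=
      Function.Embedding.nonempty_of_card_le (by simpa [hκ] using hL)
    exact ⟨Function.invFun g, Function.invFun_surjective g.injective⟩
  have hφ : ∀ i, ∃ φ : Fin r → Set X, Set.range φ = (C i : Set (Set X)) := by
    intro i
    have hne : (C i).Nonempty := by
      rw [Finset.nonempty_iff_ne_empty]
      intro he
      have := hC i
      rw [he] at this
      simp at this
    have hlt := h.card_lt (C i) (hCF i) (hC i) (hmin i)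
    have : Nonempty (C i) := hne.to_subtype
    obtain ⟨g⟩ : Nonempty (C i ↪ Fin r) :=
      Function.Embedding.nonempty_of_card_le (by simpa using hlt.le)
    refine ⟨fun a => (Function.invFun g a : C i), ?_⟩
    have := (Function.invFun_surjective g.injective).range_comp (Subtype.val : C i → Set X)
    simpa [Function.comp_def] using this
  choose φ hφ using hφ
  by_contra hcon
  push Not at hcon
  have hmemC : ∀ i a, φ i a ∈ C i := fun i a => by
    have : φ i a ∈ (C i : Set (Set X)) := hφ i ▸ Set.mem_range_self a
    exact this
  choose p hp using fun s : ι =>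
    hcon (fun i => φ i (col.symm i s)) fun i => hmemC _ _
  obtain ⟨f, x, hx⟩ := hT p
  -- In this color the points of part `d` all lie in the member numbered `π d`. As `π` is onto, the
  -- Tverberg point lies in every member.
  set i : I := col (π ∘ f) with hi
  have hmem : x ∈ ⋂₀ (C i : Set (Set X)) := by
    intro A hA
    rw [← hφ i] at hA
    obtain ⟨a, rfl⟩ := hA
    obtain ⟨d, rfl⟩ := hπ a
    refine hull_subset (hCF i (hmemC i _)) ?_ (hx d)
    rintro _ ⟨s, hs, rfl⟩
    have h1 := Set.mem_iInter.mp (hp s) i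
    have h2 : col.symm i s = π d := by
      rw [hi, Equiv.symm_apply_apply, Function.comp_apply, show f s = d from hs]
    rwa [h2] at h1
  rw [hC i] at hmem
  exact hmem


theorem le_two_pow_ceil_logb (r : ℕ) (hr : 0 < r) : r ≤ 2 ^ ⌈Real.logb 2 (r : ℝ)⌉₊ := by
  have h0 : (0 : ℝ) < r := by exact_mod_cast hr
  have h1 : (r : ℝ) ≤ (2 : ℝ) ^ ((⌈Real.logb 2 (r : ℝ)⌉₊ : ℕ) : ℝ) := by
    rw [← Real.logb_le_iff_le_rpow (by norm_num) h0]
    exact Nat.le_ceil _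
  rw [Real.rpow_natCast] at h1
  exact_mod_cast h1

/-- Families without a common point have a transversal without a common point, provided that
there are sufficiently many of them. -/
theorem exists_empty_transversal {X : Type*} [Nonempty X] {F : Set (Set X)} {Ψ : ℕ → ℕ}
    {t₀ t₁ : ℕ} (hΨ : ∀ t : ℕ, t₀ ≤ t → Ψ t < t + 1)
    (hF : ∀ t : ℕ, gradedRadonNumber F t ≤ (Ψ t : ℕ∞)) {L : ℕ} (hL : Ψ t₁ ≤ 2 ^ L)
    (ht₁ : Ψ t₁ ^ Ψ t₁ ^ L * Ψ t₀ ≤ t₁) {m : ℕ} (hm : Ψ t₁ ^ Ψ t₁ ^ L ≤ m)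
    (B : Fin m → Finset (Set X)) (hBF : ∀ i, (B i : Set (Set X)) ⊆ F)
    (hB : ∀ i, ⋂₀ (B i : Set (Set X)) = ∅) :
    ∃ v : Fin m → Set X, (∀ i, v i ∈ B i) ∧ ⋂ i, v i = ∅ := by
  classical
  choose C hCB hC hmin hcard using fun i =>
    exists_minimal_empty_card_lt hΨ hF (B i) (hBF i) (hB i)
  set a := Ψ t₁ ^ Ψ t₁ ^ L with ha
  let D : Fin a → Finset (Set X) := fun i => C (Fin.castLE hm i)
  have hDF : ∀ i, (D i : Set (Set X)) ⊆ F := fun i =>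
    (Finset.coe_subset.mpr (hCB _)).trans (hBF _)
  let U : Finset (Set X) := Finset.univ.biUnion D
  have hU : U.card ≤ t₁ := by
    refine le_trans ?_ ht₁
    refine Finset.card_biUnion_le.trans ?_
    refine (Finset.sum_le_card_nsmul _ _ (Ψ t₀) fun i _ => (hcard _).le).trans ?_
    simp
  have hUF : (U : Set (Set X)) ⊆ F := by
    intro A hA
    simp only [U, Finset.coe_biUnion, Set.mem_iUnion] at hA
    obtain ⟨i, -, hi⟩ := hA
    exact hDF i hi
  have hrad : RadonProperty (U : Set (Set X)) (Ψ t₁) :=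
    radonProperty_of_gradedRadonNumber_le (hF t₁) hUF (by
      rw [Set.encard_coe_eq_coe_finsetCard]; exact_mod_cast hU)
  obtain ⟨v, hv, hve⟩ := hrad.colorful hL inferInstance (I := Fin a) (by simp [ha]) D
    (fun i => by
      intro A hA
      exact Finset.mem_biUnion.mpr ⟨i, Finset.mem_univ _, hA⟩)
    (fun i => hC _) (fun i => hmin _)
  have hne : ∀ i, (B i).Nonempty := by
    intro i
    rw [Finset.nonempty_iff_ne_empty]
    intro he
    have := hB i
    rw [he] at this
    simp at this
  choose w hw using hne
  -- Beyond the first `a` colors any member will do: it only shrinks the intersection.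
  refine ⟨fun i => if h : i.1 < a then v ⟨i, h⟩ else w i, fun i => ?_, ?_⟩
  · by_cases h : i.1 < a
    · simp only [h, dif_pos]
      exact hCB _ (hv ⟨i, h⟩)
    · simp only [h, dif_neg, not_false_eq_true]
      exact hw i
  · rw [Set.eq_empty_iff_forall_notMem] at hve ⊢
    intro x hx
    refine hve x (Set.mem_iInter.mpr fun j => ?_)
    have := Set.mem_iInter.mp hx (Fin.castLE hm j)
    simpa using this

/-- Helly's theorem in terms of tuples. -/
theorem exists_empty_tuple {X : Type*} [Nonempty X] {F : Set (Set X)} {Ψ : ℕ → ℕ} {t₀ : ℕ}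
    (hΨ : ∀ t : ℕ, t₀ ≤ t → Ψ t < t + 1)
    (hF : ∀ t : ℕ, gradedRadonNumber F t ≤ (Ψ t : ℕ∞)) {m : ℕ} (hm : Ψ t₀ ≤ m)
    (B : Finset (Set X)) (hB : (B : Set (Set X)) ⊆ F) (hempty : ⋂₀ (B : Set (Set X)) = ∅) :
    ∃ v : Fin m → Set X, (∀ i, v i ∈ B) ∧ ⋂ i, v i = ∅ := by
  classical
  obtain ⟨C, hCB, hC, -, hcard⟩ := exists_minimal_empty_card_lt hΨ hF B hB hempty
  have hne : C.Nonempty := by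
    rw [Finset.nonempty_iff_ne_empty]
    rintro rfl
    simp at hC
  have : Nonempty C := hne.to_subtype
  obtain ⟨g⟩ : Nonempty (C ↪ Fin m) :=
    Function.Embedding.nonempty_of_card_le (by simpa using hcard.le.trans hm)
  refine ⟨fun a => (Function.invFun g a : C), fun a => hCB (Function.invFun g a).2, ?_⟩
  rw [Set.eq_empty_iff_forall_notMem] at hC ⊢
  intro x hx
  refine hC x fun A hA => ?_
  have := Set.mem_iInter.mp hx (g ⟨A, hA⟩)
  rwa [Function.leftInverse_invFun g.injective] at this

/-! ### From Helly and colorful Helly to fractional Helly -/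

theorem pow_le_mul_choose {m n : ℕ} (hm : 0 < m) (hmn : m ≤ n) :
    n ^ m ≤ m ^ m * m.factorial * n.choose m := by
  have h1 : n ≤ m * (n + 1 - m) := by
    obtain ⟨d, rfl⟩ := Nat.exists_eq_add_of_le hmn
    rw [show m + d + 1 - m = d + 1 by omega]
    nlinarith
  have h2 : (n + 1 - m) ^ m ≤ m.factorial * n.choose m := by
    rw [← Nat.descFactorial_eq_factorial_mul_choose]
    exact Nat.pow_sub_le_descFactorial n m
  calc n ^ m ≤ (m * (n + 1 - m)) ^ m := Nat.pow_le_pow_left h1 m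
    _ = m ^ m * (n + 1 - m) ^ m := mul_pow _ _ _
    _ ≤ m ^ m * (m.factorial * n.choose m) := Nat.mul_le_mul_left _ h2
    _ = _ := by ring

/-- Each intersecting subfamily is the image of a tuple enumerating it. -/
theorem intersectingCount_le_ncard {X : Type*} (F' : Finset (Set X)) (m : ℕ) :
    intersectingCount F' m ≤
      {v : Fin m → F' | ¬ ⋂ i, (v i : Set X) = ∅}.ncard := by
  classical
  rw [intersectingCount, Set.ncard_eq_toFinset_card']
  refine Finset.card_le_card_of_surjOn
    (fun v : Fin m → F' => Finset.univ.image fun i => (v i : Set X)) ?_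
  intro T hT
  simp only [Finset.coe_filter, Finset.mem_powersetCard, Set.mem_ofPred_eq] at hT
  obtain ⟨⟨hTF, hTm⟩, x, hx⟩ := hT
  let e := T.equivFinOfCardEq hTm
  refine ⟨fun i => ⟨e.symm i, hTF (e.symm i).2⟩, ?_, ?_⟩
  · simp only [Set.coe_toFinset, Set.mem_ofPred_eq]
    rw [← Ne, ← Set.nonempty_iff_ne_empty]
    exact ⟨x, Set.mem_iInter.mpr fun i => hx _ (e.symm i).2⟩
  · ext A
    simp only [Finset.mem_image, Finset.mem_univ, true_and]
    constructor
    · rintro ⟨i, rfl⟩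
      exact (e.symm i).2
    · intro hA
      exact ⟨e ⟨A, hA⟩, by simp⟩

/-- Helly's theorem and the colorful Helly theorem for `m` colors imply the fractional Helly
property. -/
theorem fractionalHellyProperty_of_colorful {X : Type*} {F : Set (Set X)} {m : ℕ} (hm : 0 < m)
    (hHelly : Nonempty X → ∀ B : Finset (Set X), (B : Set (Set X)) ⊆ F →
      ⋂₀ (B : Set (Set X)) = ∅ → ∃ v : Fin m → Set X, (∀ i, v i ∈ B) ∧ ⋂ i, v i = ∅)
    (hcol : Nonempty X → ∀ B : Fin m → Finset (Set X), (∀ i, (B i : Set (Set X)) ⊆ F) →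
      (∀ i, ⋂₀ (B i : Set (Set X)) = ∅) →
      ∃ v : Fin m → Set X, (∀ i, v i ∈ B i) ∧ ⋂ i, v i = ∅) :
    FractionalHellyProperty F m := by
  classical
  have hconst : (0 : ℝ) < (m : ℝ) ^ m * m.factorial := by
    have : (0 : ℝ) < m := by exact_mod_cast hm
    have := m.factorial_pos
    positivity
  -- The divisor turns a fraction of the `m`-subsets into a fraction of all `m`-tuples.
  choose β hβ0 hβ1 hβ using fun α : Set.Ioo (0 : ℝ) 1 =>
    exists_large_clique hm ((α : ℝ) / ((m : ℝ) ^ m * m.factorial)) (div_pos α.2.1 hconst)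
  refine ⟨fun α => ⟨β α, hβ0 α, hβ1 α⟩, fun α F' hF' hmF hcount => ?_⟩
  rw [Finset.card_powersetCard] at hcount
  have hX : Nonempty X := by
    have h1 : (0 : ℝ) < intersectingCount F' m := by
      refine lt_of_lt_of_le (mul_pos α.2.1 ?_) hcount
      exact_mod_cast Nat.choose_pos hmF
    have h2 : 0 < intersectingCount F' m := by exact_mod_cast h1
    obtain ⟨T, hT⟩ := Finset.card_pos.mp h2
    exact ⟨(Finset.mem_filter.mp hT).2.some⟩
  have hV : Nonempty F' :=
    (Finset.card_pos.mp (hm.trans_le hmF)).to_subtype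
  obtain ⟨U, hUcard, hU⟩ := hβ α F' (fun v => ⋂ i, (v i : Set X) = ∅) (by
    intro M hM
    obtain ⟨v, hv, hve⟩ := hcol hX (fun i => Finset.univ.image fun j => (M i j : Set X))
      (fun i A hA => by
        simp only [Finset.coe_image, Finset.coe_univ, Set.image_univ, Set.mem_range] at hA
        obtain ⟨j, rfl⟩ := hA
        exact hF' (M i j).2)
      (fun i => by simpa [Set.sInter_range] using hM i)
    simp only [Finset.mem_image, Finset.mem_univ, true_and] at hv
    choose e he using hv
    exact ⟨e, by simpa [he] using hve⟩) (by
    have h1 : ((intersectingCount F' m : ℕ) : ℝ) ≤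
        ({v : Fin m → F' | ¬ ⋂ i, (v i : Set X) = ∅}.ncard : ℝ) := by
      exact_mod_cast intersectingCount_le_ncard F' m
    refine le_trans (le_trans ?_ hcount) h1
    have h2 : ((F'.card : ℝ)) ^ m ≤ (m : ℝ) ^ m * m.factorial * (F'.card.choose m : ℝ) := by
      exact_mod_cast pow_le_mul_choose hm hmF
    rw [Fintype.card_coe, div_mul_eq_mul_div, div_le_iff₀ hconst]
    have := mul_le_mul_of_nonneg_left h2 α.2.1.le
    linarith)
  let G : Finset (Set X) := U.toFinset.image Subtype.val
  have hGF : G ⊆ F' := by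
    intro A hA
    obtain ⟨a, -, rfl⟩ := Finset.mem_image.mp hA
    exact a.2
  refine ⟨G, hGF, ?_, ?_⟩
  · have : G.card = U.ncard := by
      rw [Finset.card_image_of_injective _ Subtype.val_injective, Set.ncard_eq_toFinset_card']
    rw [this]
    simpa using hUcard
  · rw [Set.nonempty_iff_ne_empty]
    intro hGe
    obtain ⟨v, hv, hve⟩ := hHelly hX G ((Finset.coe_subset.mpr hGF).trans hF') hGe
    refine hU (fun i => ⟨v i, hGF (hv i)⟩) (fun i => ?_) (by simpa using hve)
    obtain ⟨a, ha, hav⟩ := Finset.mem_image.mp (hv i)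
    have : (⟨v i, hGF (hv i)⟩ : F') = a := Subtype.ext hav.symm
    rw [this]
    simpa using ha

end SetSystem

theorem theorem1p6 (Ψ : ℕ → ℕ) (t₀ : ℕ) (hΨ : ∀ t : ℕ, t₀ ≤ t → Ψ t < t + 1)
    (t₁ : ℕ) (ht₁ : t₀ ^ 2 ≤ t₁)
    (hΞ : (SetSystem.Xi (Ψ t₁) : ℝ) < (t₁ : ℝ) / (Ψ t₀ : ℝ)) :
    ∃ N : ℕ, ∀ (X : Type*) (F : Set (Set X)),
      (∀ t : ℕ, SetSystem.gradedRadonNumber F t ≤ (Ψ t : ℕ∞)) →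
      SetSystem.fractionalHellyNumber F ≤ (N : ℕ∞) := by
  set L := ⌈Real.logb 2 (Ψ t₁ : ℝ)⌉₊ with hL
  -- Enough for the number of colors and for the Helly number; the 1 makes positivity immediate.
  refine ⟨Ψ t₁ ^ Ψ t₁ ^ L + Ψ t₀ + 1, fun X F hF => ?_⟩
  -- The empty subfamily has the Radon property at `Ψ t₁`, which is impossible at 0: the empty set
  -- has no nonempty parts.
  have hr : 0 < Ψ t₁ :=
    (SetSystem.radonProperty_of_gradedRadonNumber_le (hF t₁) (Set.empty_subset F)
      (by simp)).pos
  have hcard : Ψ t₁ ^ Ψ t₁ ^ L * Ψ t₀ ≤ t₁ := by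
    have h0 : 0 < (Ψ t₀ : ℝ) := by
      have : 0 < Ψ t₀ := (SetSystem.radonProperty_of_gradedRadonNumber_le (hF t₀)
        (Set.empty_subset F) (by simp)).pos
      exact_mod_cast this
    have h1 : SetSystem.Xi (Ψ t₁) * Ψ t₀ < t₁ := by
      have := (lt_div_iff₀ h0).mp hΞ
      exact_mod_cast this
    refine le_trans (Nat.mul_le_mul_right _ ?_) h1.le
    exact Nat.pow_le_pow_right hr (Nat.le_add_right _ _)
  refine iInf₂_le _ (SetSystem.fractionalHellyProperty_of_colorful (Nat.succ_pos _) ?_ ?_)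
  · intro _ B hB hempty
    exact SetSystem.exists_empty_tuple hΨ hF (by omega) B hB hempty
  · intro _ B hBF hB
    exact SetSystem.exists_empty_transversal hΨ hF (SetSystem.le_two_pow_ceil_logb _ hr) hcard
      ((Nat.le_add_right _ _).trans (Nat.le_succ _)) B hBF hB
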